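/- Conventions. Let $G$ be a group. Its rational derived series is $G_r^{(0)}=G$ and $$G_r^{(n+1)}=\{g\in G_r^{(n)} : g^k\in[G_r^{(n)},G_r^{(n)}]\text{ for some }k\in\mathbb Z\setminus\{0\}\},$$ a sequence of normal subgroups of $G$; put $\Gamma_n=G/G_r^{(n+1)}$. Let $\varphi\colon G\to\mathbb Z$ be a homomorphism. It is trivial on $G_r^{(n+1)}$; let $\bar\Gamma_n\subseteq\Gamma_n$ be the kernel of the induced homomorphism $\Gamma_n\to\mathbb Z$. The ring $\mathbb Z\bar\Gamma_n$ is a right Ore domain; let $\mathbb K_n=\mathbb Z\bar\Gamma_n(\mathbb Z\bar\Gamma_n\setminus\{0\})^{-1}$ be its skew field of right quotients. Regard $G_r^{(n+1)}/[G_r^{(n+1)},G_r^{(n+1)}]$ as a right $\mathbb Z\Gamma_n$-module, hence as a right $\mathbb Z\bar\Gamma_n$-module, through conjugation $[h]\cdot g=[g^{-1}hg]$. The first higher-order degree of $G$ (with respect to $\varphi$) is the dimension (a cardinal, possibly infinite) of the right $\mathbb K_n$-vector space $$\delta_n(G)=\operatorname{rk}_{\mathbb K_n}\Bigl(G_r^{(n+1)}/[G_r^{(n+1)},G_r^{(n+1)}]\otimes_{\mathbb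 Z\bar\Gamma_n}\mathbb K_n\Bigr).$$ Proposition 10.2. Let $G$ be a group with a homomorphism $\varphi\colon G\to\mathbb Z$, let $H=\{h\in G : h^k=1\text{ for some }k\ge 1\}$ be the set of torsion elements of $G$, let $N$ be the normal closure of $H$ in $G$, and let $\widehat G=G/N$, with the homomorphism $\widehat G\to\mathbb Z$ induced by $\varphi$ (which is trivial on $N$). Then, for every $n\ge 0$, $$\delta_n(G)=\delta_n(\widehat G).$$ In particular, for every $d\ge 1$ and $n\ge 0$, writing $\mathbb Z_d=\mathbb Z/d\mathbb Z$, $$\delta_n(G\times\mathbb Z_d)=\delta_n(G)=\delta_n(G*\mathbb Z_d),$$ where $G\times\mathbb Z_d$ and $G*\mathbb Z_d$ carry the homomorphisms to $\mathbb Z$ that equal $\varphi$ on $G$ and are trivial on $\mathbb Z_d$. -/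

import Mathlib

universe u

namespace HigherOrderDegree

/-! ### Unique products

Needed to know that the integral group rings below have no zero divisors. -/

theorem uniqueProds_of_torsionFree {A : Type*} [CommGroup A]
    (h : ∀ (a : A) (k : ℕ), k ≠ 0 → a ^ k = 1 → a = 1) : UniqueProds A := by
  have : IsAddTorsionFree (Additive A) := by
    refine ⟨fun k hk a b hab => ?_⟩
    have hab' : a.toMul ^ k = b.toMul ^ k := hab
    have h1 : (a.toMul / b.toMul : A) ^ k = 1 := by
      rw [div_pow (α := A), hab', div_self' (G := A)]
    exact div_eq_one (G := A) |>.1 (h _ k hk h1)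
  have h2 : TwoUniqueSums (Additive A) :=
    TwoUniqueSums.of_injective_addHom (DivisibleHull.coeAddMonoidHom (Additive A) : Additive A →+ _).toAddHom
      DivisibleHull.coe_injective inferInstance
  have h3 : TwoUniqueProds (Multiplicative (Additive A)) := inferInstance
  have h4 : UniqueProds (Multiplicative (Additive A)) := inferInstance
  exact h4

theorem uniqueProds_of_ker {G Q : Type*} [Group G] [Group Q] (f : G →* Q)
    [UniqueProds Q] [UniqueProds f.ker] : UniqueProds G := by
  classical
  refine ⟨fun {A B} hA hB => ?_⟩
  obtain ⟨x, hx, y, hy, hu⟩ := UniqueProds.uniqueMul_of_nonempty (hA.image f) (hB.image f)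
  obtain ⟨a, ha, rfl⟩ := Finset.mem_image.1 hx
  obtain ⟨b, hb, rfl⟩ := Finset.mem_image.1 hy
  let l : f.ker → G := fun k => a * k
  let r : f.ker → G := fun k => k * b
  have hl : Function.Injective l := fun k k' e => Subtype.ext (mul_left_cancel e)
  have hr : Function.Injective r := fun k k' e => Subtype.ext (mul_right_cancel e)
  obtain ⟨u, hu', v, hv, huv⟩ := UniqueProds.uniqueMul_of_nonempty
    (A := A.preimage l hl.injOn) (B := B.preimage r hr.injOn)
    ⟨1, by simpa [l] using ha⟩ ⟨1, by simpa [r] using hb⟩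
  rw [Finset.mem_preimage] at hu' hv
  have hfu : f (u : G) = 1 := u.2
  have hfv : f (v : G) = 1 := v.2
  refine ⟨a * u, hu', v * b, hv,
    UniqueMul.of_image_filter (f : G →ₙ* Q) (by simp [hfu]) (by simp [hfv]) hu ?_⟩
  intro p q hp hq e
  rw [Finset.mem_filter] at hp hq
  have h := huv (a := ⟨a⁻¹ * p, by simpa [MonoidHom.mem_ker, inv_mul_eq_one] using hp.2.symm⟩)
    (b := ⟨q * b⁻¹, by simpa [MonoidHom.mem_ker, mul_inv_eq_one] using hq.2⟩)
    (by simpa [l] using hp.1) (by simpa [r] using hq.1)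
    (Subtype.ext (by
      change a⁻¹ * p * (q * b⁻¹) = u * v
      calc a⁻¹ * p * (q * b⁻¹) = a⁻¹ * (p * q) * b⁻¹ := by group
        _ = u * v := by rw [e]; group))
  have h1 := congrArg Subtype.val h.1
  have h2 := congrArg Subtype.val h.2
  exact ⟨inv_mul_eq_iff_eq_mul.1 h1, mul_inv_eq_iff_eq_mul.1 h2⟩


/-! ### The Ore condition for integral group rings of solvable groups -/

open Pointwise in
theorem card_pow_le {Q : Type*} [CommGroup Q] [DecidableEq Q] (S : Finset Q) (M : ℕ) :
    (S ^ M).card ≤ (M + 1) ^ S.card := by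
  have key : ∀ M : ℕ, ∀ x ∈ S ^ M, ∃ c : Q → ℕ, (∀ s, c s ≤ M) ∧ ∏ s ∈ S, s ^ c s = x := by
    intro M
    induction M with
    | zero =>
      intro x hx
      exact ⟨fun _ => 0, fun _ => le_rfl, by simpa [eq_comm] using hx⟩
    | succ M ih =>
      intro x hx
      rw [pow_succ] at hx
      obtain ⟨y, hy, z, hz, rfl⟩ := Finset.mem_mul.1 hx
      obtain ⟨c, hc, rfl⟩ := ih y hy
      refine ⟨fun s => c s + if s = z then 1 else 0, fun s => ?_, ?_⟩
      · have := hc s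
        dsimp only
        split_ifs <;> omega
      · simp only [pow_add, Finset.prod_mul_distrib]
        congr 1
        simp [pow_ite, hz]
  calc (S ^ M).card
      ≤ ((Fintype.piFinset fun _ : S => Finset.range (M + 1)).image
          fun c => ∏ s : S, (s : Q) ^ c s).card := by
        refine Finset.card_le_card fun x hx => ?_
        obtain ⟨c, hc, rfl⟩ := key M x hx
        refine Finset.mem_image.2 ⟨fun s => c s, ?_, ?_⟩
        · simpa [Nat.lt_succ_iff] using fun s _ => hc s
        · exact Finset.prod_coe_sort S fun s => s ^ c s
    _ ≤ (Fintype.piFinset fun _ : S => Finset.range (M + 1)).card := Finset.card_image_le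
    _ = (M + 1) ^ S.card := by simp

open Pointwise in
theorem growth {Q : Type*} [CommGroup Q] [DecidableEq Q] (S : Finset Q) {m p : ℕ} (h : m < p) :
    ∃ M : ℕ, m * (S ^ (M + 1)).card < p * (S ^ M).card := by
  by_contra! hc
  have h1 : ∀ M : ℕ, p ^ M ≤ m ^ M * (S ^ M).card := by
    intro M
    induction M with
    | zero => simp
    | succ M ih =>
      calc p ^ (M + 1) = p ^ M * p := pow_succ _ _
        _ ≤ m ^ M * (S ^ M).card * p := by gcongr
        _ = m ^ M * (p * (S ^ M).card) := by ring
        _ ≤ m ^ M * (m * (S ^ (M + 1)).card) := Nat.mul_le_mul_left _ (hc M)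
        _ = _ := by ring
  have hp : (0 : ℝ) < p := by exact_mod_cast (Nat.zero_le m).trans_lt h
  have h2 : ∀ M : ℕ, (1 : ℝ) ≤ ((m : ℝ) / p) ^ M * ((M : ℝ) + 1) ^ S.card := by
    intro M
    have h3 : (p : ℝ) ^ M ≤ (m : ℝ) ^ M * ((M : ℝ) + 1) ^ S.card := by
      exact_mod_cast (h1 M).trans (Nat.mul_le_mul_left _ (card_pow_le S M))
    rw [div_pow, div_mul_eq_mul_div, le_div_iff₀ (by positivity), one_mul]
    exact h3
  have hr0 : (0 : ℝ) ≤ (m : ℝ) / p := by positivity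
  have hr1 : (m : ℝ) / p < 1 := by
    rw [div_lt_one hp]; exact_mod_cast h
  rcases hr0.eq_or_lt with h0 | h0
  · have := h2 1
    rw [← h0] at this
    norm_num at this
  have hlim := (tendsto_pow_const_mul_const_pow_of_abs_lt_one S.card
    (by rwa [abs_of_nonneg hr0])).comp (Filter.tendsto_add_atTop_nat 1)
  obtain ⟨M, hM⟩ := (hlim.eventually (gt_mem_nhds h0)).exists
  have h4 := mul_le_mul_of_nonneg_left (h2 M) hr0
  simp only [Function.comp, Nat.cast_add, Nat.cast_one] at hM
  rw [pow_succ] at hM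
  nlinarith

/-- The elements of `ℤ[G]` supported on a subgroup. -/
noncomputable def supportedOn {G : Type*} [Group G] (H : Subgroup G) : Subring (MonoidAlgebra ℤ G) :=
  (MonoidAlgebra.mapDomainRingHom ℤ H.subtype).range

section
variable {G : Type*} [Group G]
open MonoidAlgebra

theorem single_mem {H : Subgroup G} {g : G} (hg : g ∈ H) (c : ℤ) : single g c ∈ supportedOn H :=
  ⟨single ⟨g, hg⟩ c, by simp⟩

theorem mem_supportedOn {H : Subgroup G} {x : MonoidAlgebra ℤ G} :
    x ∈ supportedOn H ↔ ∀ g ∉ H, x.coeff g = 0 := by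
  constructor
  · rintro ⟨y, rfl⟩ g hg
    induction y using MonoidAlgebra.induction_linear with
    | zero => simp
    | add a b ha hb => rw [map_add, coeff_add, Finsupp.add_apply, ha, hb, add_zero]
    | single a b =>
      have : (a : G) ≠ g := fun e => hg (e ▸ a.2)
      simp [this]
  · intro h
    rw [← sum_coeff_single x]
    refine Subring.sum_mem _ fun g hg => single_mem ?_ _
    by_contra hn
    exact Finsupp.mem_support_iff.1 hg (h g hn)

theorem supportedOn_mono {H K : Subgroup G} (h : H ≤ K) : supportedOn H ≤ supportedOn K := fun _ hx =>
  mem_supportedOn.2 fun g hg => mem_supportedOn.1 hx g fun hn => hg (h hn)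

/-- Homogeneous systems over `ℤ[H]` with fewer equations than unknowns have a solution. -/
def Solv (H : Subgroup G) : Prop :=
  ∀ (I J : Type) [Fintype I] [Fintype J], Fintype.card I < Fintype.card J →
    ∀ a : I → J → MonoidAlgebra ℤ G, (∀ i j, a i j ∈ supportedOn H) →
      ∃ x : J → MonoidAlgebra ℤ G, (∀ j, x j ∈ supportedOn H) ∧ x ≠ 0 ∧ ∀ i, ∑ j, a i j * x j = 0

theorem Solv.gen {H : Subgroup G} (h : Solv H) {I J : Type*} [Fintype I] [Fintype J]
    (hc : Fintype.card I < Fintype.card J) (a : I → J → MonoidAlgebra ℤ G)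
    (ha : ∀ i j, a i j ∈ supportedOn H) :
    ∃ x : J → MonoidAlgebra ℤ G, (∀ j, x j ∈ supportedOn H) ∧ x ≠ 0 ∧ ∀ i, ∑ j, a i j * x j = 0 := by
  let eI := Fintype.equivFin I
  let eJ := Fintype.equivFin J
  obtain ⟨x, hx, hx0, hs⟩ := h (Fin (Fintype.card I)) (Fin (Fintype.card J)) (by simpa using hc)
    (fun i j => a (eI.symm i) (eJ.symm j)) fun _ _ => ha _ _
  refine ⟨fun j => x (eJ j), fun j => hx _, fun e => hx0 ?_, fun i => ?_⟩
  · funext j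
    simpa using congrFun e (eJ.symm j)
  · have := hs (eI i)
    rw [← eJ.sum_comp] at this
    simpa using this

theorem solv_bot : Solv (⊥ : Subgroup G) := by
  intro I J _ _ hc a ha
  have hb : ∀ i j, a i j = single 1 ((a i j).coeff 1) := by
    intro i j
    ext g
    by_cases hg : g = 1
    · subst hg; simp
    · rw [mem_supportedOn.1 (ha i j) g (by simpa using hg)]
      simp [Ne.symm hg]
  let f : (J → ℤ) →ₗ[ℤ] (I → ℤ) := Matrix.mulVecLin (Matrix.of fun i j => (a i j).coeff 1)
  have hf : ¬ Function.Injective f := fun hf => by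
    have := card_le_of_injective ℤ f hf
    omega
  rw [← LinearMap.ker_eq_bot, Submodule.eq_bot_iff] at hf
  push Not at hf
  obtain ⟨x, hx, hx0⟩ := hf
  refine ⟨fun j => single 1 (x j), fun j => single_mem (one_mem _) _, fun e => hx0 ?_, fun i => ?_⟩
  · funext j
    simpa using congrFun e j
  · have h1 : ∑ j, (a i j).coeff 1 * x j = 0 := congrFun hx i
    calc ∑ j, a i j * single 1 (x j) = ∑ j, single (1 : G) ((a i j).coeff 1 * x j) := by
          refine Finset.sum_congr rfl fun j _ => ?_
          rw [hb i j]; simp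
      _ = singleAddHom 1 (∑ j, (a i j).coeff 1 * x j) := by rw [map_sum]; rfl
      _ = 0 := by rw [h1]; simp

open Pointwise in
theorem solv_step {H K : Subgroup G} (hHK : H ≤ K) {Q : Type*} [CommGroup Q] (q : K →* Q)
    (hq : ∀ k : K, q k = 1 ↔ (k : G) ∈ H) (hs : Function.Surjective q) (hH : Solv H) : Solv K := by
  classical
  intro I J _ _ hc a ha
  let S : Finset Q := Finset.univ.biUnion fun ij : I × J =>
    (a ij.1 ij.2).coeff.support.attach.image fun g : ↥(a ij.1 ij.2).coeff.support => q ⟨g.1, by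
      by_contra hn
      exact Finsupp.mem_support_iff.1 g.2 (mem_supportedOn.1 (ha _ _) _ hn)⟩
  obtain ⟨M, hM⟩ := growth S hc
  let s : Q → K := Function.surjInv hs
  have hsq : ∀ u, q (s u) = u := Function.surjInv_eq hs
  -- decomposition along cosets
  have dec : ∀ i j (t : Q), t ∈ S ^ M → ∃ b : Q → MonoidAlgebra ℤ G, (∀ u, b u ∈ supportedOn H) ∧
      a i j * single (s t : G) 1 = ∑ u ∈ S ^ (M + 1), single (s u : G) 1 * b u := by
    intro i j t ht
    have gen : ∀ (T : Finset G), T ⊆ (a i j).coeff.support →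
        ∃ b : Q → MonoidAlgebra ℤ G, (∀ u, b u ∈ supportedOn H) ∧
        (∑ g ∈ T, single g ((a i j).coeff g)) * single (s t : G) 1 =
          ∑ u ∈ S ^ (M + 1), single (s u : G) 1 * b u := by
      intro T
      induction T using Finset.induction_on with
      | empty => intro _; exact ⟨0, fun _ => zero_mem _, by simp⟩
      | insert g T hg ih =>
        intro hT
        obtain ⟨b, hb, hbe⟩ := ih fun x hx => hT (Finset.mem_insert_of_mem hx)
        have hgs := hT (Finset.mem_insert_self g T)
        have hgK : g ∈ K := by
          by_contra hn
          exact Finsupp.mem_support_iff.1 hgs (mem_supportedOn.1 (ha _ _) _ hn)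
        let v : Q := q (⟨g, hgK⟩ * s t)
        have hv : v ∈ S ^ (M + 1) := by
          rw [pow_succ', show v = q ⟨g, hgK⟩ * t from (map_mul q _ _).trans (by rw [hsq])]
          refine Finset.mul_mem_mul ?_ ht
          exact Finset.mem_biUnion.2 ⟨(i, j), Finset.mem_univ _,
            Finset.mem_image.2 ⟨⟨g, hgs⟩, Finset.mem_attach _ _, rfl⟩⟩
        refine ⟨fun u => b u + if u = v then
          single ((s v : G)⁻¹ * (g * s t)) ((a i j).coeff g) else 0, fun u => ?_, ?_⟩
        · refine add_mem (hb u) ?_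
          split_ifs
          · refine single_mem ?_ _
            have : q ((s v)⁻¹ * (⟨g, hgK⟩ * s t)) = 1 := by
              rw [map_mul, map_inv, hsq, inv_mul_cancel]
            exact (hq _).1 this
          · exact zero_mem _
        · rw [Finset.sum_insert hg, add_mul, hbe]
          simp only [mul_add, Finset.sum_add_distrib, mul_ite, mul_zero, Finset.sum_ite_eq', hv,
            if_true, single_mul_single]
          rw [add_comm]
          simp
    obtain ⟨b, hb, hbe⟩ := gen _ subset_rfl
    refine ⟨b, hb, ?_⟩
    rw [← hbe]
    congr 1
    exact (sum_coeff_single (a i j)).symm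
  choose! b hb hbe using dec
  obtain ⟨y, hy, hy0, hys⟩ := hH.gen (I := I × ↥(S ^ (M + 1))) (J := J × ↥(S ^ M))
    (by simpa using hM) (fun iu jt => b iu.1 jt.1 jt.2 iu.2) fun iu jt => hb _ _ _ jt.2.2 _
  refine ⟨fun j => ∑ t : ↥(S ^ M), single (s t : G) 1 * y (j, t), fun j => ?_, fun e => hy0 ?_,
    fun i => ?_⟩
  · exact sum_mem fun t _ => mul_mem (single_mem (s t).2 _) (supportedOn_mono hHK (hy _))
  · funext ⟨j, t⟩
    ext g
    by_cases hg : g ∈ H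
    swap
    · simpa using mem_supportedOn.1 (hy (j, t)) g hg
    have h1 := congrArg (fun z => z.coeff ((s t : G) * g)) (congrFun e j)
    simp only [coeff_sum, Finsupp.finsetSum_apply] at h1
    rw [Finset.sum_eq_single t] at h1
    · simpa [coeff_single_mul_apply] using h1
    · intro t' _ htt
      rw [coeff_single_mul_apply, mem_supportedOn.1 (hy (j, t')), mul_zero]
      intro hn
      apply htt
      have h2 : ((s t')⁻¹ * s t : K).1 ∈ H := by
        have := H.mul_mem hn (H.inv_mem hg)
        simpa [mul_assoc] using this
      have h3 := (hq _).2 h2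
      rw [map_mul, map_inv, hsq, hsq, inv_mul_eq_one] at h3
      exact Subtype.ext h3
    · simp
  · calc ∑ j, a i j * ∑ t : ↥(S ^ M), single (s t : G) 1 * y (j, t)
        = ∑ j, ∑ t : ↥(S ^ M), ∑ u : ↥(S ^ (M + 1)),
            single (s u : G) 1 * (b i j t u * y (j, t)) := by
          refine Finset.sum_congr rfl fun j _ => ?_
          rw [Finset.mul_sum]
          refine Finset.sum_congr rfl fun t _ => ?_
          rw [← mul_assoc, hbe i j t t.2, Finset.sum_mul, ← Finset.sum_coe_sort]
          simp only [mul_assoc]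
      _ = ∑ u : ↥(S ^ (M + 1)), single (s u : G) 1 *
            ∑ jt : J × ↥(S ^ M), b i jt.1 jt.2 u * y jt := by
          simp only [Finset.mul_sum, Fintype.sum_prod_type]
          symm
          rw [Finset.sum_comm]
          exact Finset.sum_congr rfl fun j _ => Finset.sum_comm
      _ = 0 := by
          refine Finset.sum_eq_zero fun u _ => ?_
          rw [hys (i, u), mul_zero]

theorem solv_top [Group.IsSolvable G] : Solv (⊤ : Subgroup G) := by
  obtain ⟨n, hn⟩ := Group.IsSolvable.solvable (G := G)
  have key : ∀ k ≤ n, Solv (derivedSeries G (n - k)) := by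
    intro k
    induction k with
    | zero => intro _; rw [Nat.sub_zero, hn]; exact solv_bot
    | succ k ih =>
      intro hk
      have e : n - k = (n - (k + 1)) + 1 := by omega
      have h := ih (by omega)
      rw [e] at h
      refine solv_step (derivedSeries_antitone G (Nat.le_succ _))
        (Abelianization.of (G := derivedSeries G (n - (k + 1)))) (fun x => ?_)
        (QuotientGroup.mk'_surjective _) h
      rw [← MonoidHom.mem_ker, Abelianization.ker_of, derivedSeries_succ,
        ← Subgroup.map_subtype_commutator]
      simp
  simpa using key n le_rfl

/-- The integral group ring of a solvable group with unique products satisfies the right Ore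
condition. -/
theorem exists_oreSet [Group.IsSolvable G] [UniqueProds G] :
    Nonempty (OreLocalization.OreSet (nonZeroDivisors (MonoidAlgebra ℤ G)ᵐᵒᵖ)) := by
  rw [OreLocalization.nonempty_oreSet_iff_of_noZeroDivisors]
  intro r s
  have hs0 : s.1.unop ≠ 0 := fun h =>
    nonZeroDivisors.ne_zero s.2 (MulOpposite.unop_injective h)
  have mem_top : ∀ x : MonoidAlgebra ℤ G, x ∈ supportedOn (⊤ : Subgroup G) := fun x =>
    mem_supportedOn.2 fun g hg => absurd (Subgroup.mem_top g) hg
  obtain ⟨x, -, hx0, hx⟩ := solv_top (G := G) Unit Bool (by simp)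
    (fun _ j => if j then r.unop else - s.1.unop) fun _ _ => mem_top _
  have h := hx ()
  simp only [Fintype.sum_bool, if_true, Bool.false_eq_true, if_false, neg_mul] at h
  have h : r.unop * x true = s.1.unop * x false := by rwa [add_neg_eq_zero] at h
  have hxt : x true ≠ 0 := by
    intro h1
    rw [h1, mul_zero] at h
    have h2 : x false = 0 := (mul_eq_zero.1 h.symm).resolve_left hs0
    exact hx0 (funext fun j => by cases j <;> assumption)
  refine ⟨.op (x false), ⟨.op (x true), mem_nonZeroDivisors_of_ne_zero ?_⟩, ?_⟩
  · simpa using hxt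
  · exact MulOpposite.unop_injective h

end

/-! ### Rings of right quotients and tensor products over noncommutative rings -/

noncomputable instance {G : Type*} [Group G] [Group.IsSolvable G] [UniqueProds G] :
    OreLocalization.OreSet (nonZeroDivisors (MonoidAlgebra ℤ G)ᵐᵒᵖ) :=
  Classical.choice exists_oreSet

/-- The classical ring of right quotients of `R`, whose elements are the right fractions `r s⁻¹`
with `s` a nonzerodivisor. Mathlib's `OreLocalization` consists of left fractions, so it is applied
to the opposite ring. -/
abbrev RightFrac (R : Type*) [Ring R] [OreLocalization.OreSet (nonZeroDivisors Rᵐᵒᵖ)] : Type _ :=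
  (OreLocalization (nonZeroDivisors Rᵐᵒᵖ) Rᵐᵒᵖ)ᵐᵒᵖ

/-- The canonical map of `R` to its ring of right quotients. -/
noncomputable def toRightFrac (R : Type*) [Ring R]
    [OreLocalization.OreSet (nonZeroDivisors Rᵐᵒᵖ)] : R →+* RightFrac R :=
  (RingHom.op (OreLocalization.numeratorRingHom (R := Rᵐᵒᵖ) (S := nonZeroDivisors Rᵐᵒᵖ))).comp
    (RingEquiv.opOp R).toRingHom

open scoped TensorProduct in
/-- The right `K`-module `A ⊗_R K`, for a right `R`-module `A` (that is, a module over `Rᵐᵒᵖ`) and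
a ring homomorphism `i : R →+* K`: the quotient of the tensor product over `ℤ` by the relations
`a r ⊗ k = a ⊗ i(r) k`. The factors are written in the order `k ⊗ a`, so that `Kᵐᵒᵖ` acts by right
multiplication on the factor `K` through the instance in Mathlib. -/
abbrev BalancedTensor {R K : Type*} [Ring R] [Ring K] (i : R →+* K)
    (A : Type*) [AddCommGroup A] [Module Rᵐᵒᵖ A] : Type _ :=
  (K ⊗[ℤ] A) ⧸ Submodule.span Kᵐᵒᵖ
    {x : K ⊗[ℤ] A | ∃ (r : R) (k : K) (a : A),
      x = k ⊗ₜ[ℤ] (MulOpposite.op r • a) - (i r * k) ⊗ₜ[ℤ] a}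

/-! ### The rational derived series -/

section RationalDerivedSeries
variable {G : Type u} [Group G]

theorem mem_commutator_iff (P : Subgroup G) (x : P) :
    (x : G) ∈ ⁅P, P⁆ ↔ Abelianization.of x = 1 := by
  rw [← MonoidHom.mem_ker, Abelianization.ker_of, ← Subgroup.map_subtype_commutator]
  simp

/-- The elements of `P` having a nonzero power in `[P, P]`. -/
def rationalCommutator (P : Subgroup G) : Subgroup G where
  carrier := {g | g ∈ P ∧ ∃ k : ℤ, k ≠ 0 ∧ g ^ k ∈ ⁅P, P⁆}
  one_mem' := ⟨P.one_mem, 1, one_ne_zero, by simp⟩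
  inv_mem' := by
    rintro g ⟨hg, k, hk, h⟩
    exact ⟨P.inv_mem hg, k, hk, by simpa using h⟩
  mul_mem' := by
    rintro g h ⟨hg, k, hk, hgk⟩ ⟨hh, l, hl, hhl⟩
    refine ⟨P.mul_mem hg hh, k * l, mul_ne_zero hk hl, ?_⟩
    have h1 := (mem_commutator_iff P (⟨g, hg⟩ ^ k)).1 hgk
    have h2 := (mem_commutator_iff P (⟨h, hh⟩ ^ l)).1 hhl
    refine (mem_commutator_iff P ((⟨g, hg⟩ * ⟨h, hh⟩) ^ (k * l))).2 ?_
    rw [map_zpow] at h1 h2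
    rw [map_zpow, map_mul, mul_zpow, zpow_mul, h1, one_zpow, mul_comm k l, zpow_mul, h2, one_zpow,
      one_mul]

instance (P : Subgroup G) [P.Normal] : (rationalCommutator P).Normal where
  conj_mem := by
    rintro g ⟨hg, k, hk, h⟩ x
    refine ⟨‹P.Normal›.conj_mem g hg x, k, hk, ?_⟩
    rw [conj_zpow]
    exact (Subgroup.commutator_normal P P).conj_mem _ h x

variable (G) in
/-- The rational derived series `G_r^{(n)}`. -/
def rationalDerivedSeries : ℕ → Subgroup G
  | 0 => ⊤
  | n + 1 => rationalCommutator (rationalDerivedSeries n)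

instance rationalDerivedSeries_normal : ∀ n : ℕ, (rationalDerivedSeries G n).Normal
  | 0 => inferInstanceAs (⊤ : Subgroup G).Normal
  | n + 1 =>
    have := rationalDerivedSeries_normal n
    inferInstanceAs (rationalCommutator (rationalDerivedSeries G n)).Normal

theorem rationalDerivedSeries_succ_le (n : ℕ) :
    rationalDerivedSeries G (n + 1) ≤ rationalDerivedSeries G n := fun _ h => h.1

theorem quotient_solvable_and_uniqueProds (n : ℕ) :
    Group.IsSolvable (G ⧸ rationalDerivedSeries G n) ∧
      UniqueProds (G ⧸ rationalDerivedSeries G n) := by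
  induction n with
  | zero =>
    have : Subsingleton (G ⧸ rationalDerivedSeries G 0) :=
      QuotientGroup.subsingleton_quotient_top
    exact ⟨inferInstance, uniqueProds_of_torsionFree
      (A := Unit) (fun _ _ _ _ => rfl) |> UniqueProds.of_injective_mulHom
        (1 : G ⧸ rationalDerivedSeries G 0 →* Unit).toMulHom (Function.injective_of_subsingleton _)⟩
  | succ n ih =>
    obtain ⟨ih1, ih2⟩ := ih
    let f : G ⧸ rationalDerivedSeries G (n + 1) →* G ⧸ rationalDerivedSeries G n :=
      QuotientGroup.map _ _ (MonoidHom.id G) (rationalDerivedSeries_succ_le n)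
    have hmk : ∀ x : f.ker, ∃ g ∈ rationalDerivedSeries G n, (g : G ⧸ _) = x.1 := by
      rintro ⟨x, hx⟩
      obtain ⟨g, rfl⟩ := QuotientGroup.mk_surjective x
      exact ⟨g, (QuotientGroup.eq_one_iff g).1 hx, rfl⟩
    have hcomm : ∀ x y : f.ker, x * y = y * x := by
      intro x y
      obtain ⟨g, hg, hgx⟩ := hmk x
      obtain ⟨h, hh, hhy⟩ := hmk y
      apply Subtype.ext
      rw [Subgroup.coe_mul, Subgroup.coe_mul, ← hgx, ← hhy, ← QuotientGroup.mk_mul,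
        ← QuotientGroup.mk_mul, ← inv_mul_eq_one, ← QuotientGroup.mk_inv, ← QuotientGroup.mk_mul,
        QuotientGroup.eq_one_iff]
      have hc : (g * h)⁻¹ * (h * g) ∈ ⁅rationalDerivedSeries G n, rationalDerivedSeries G n⁆ := by
        have := Subgroup.commutator_mem_commutator (Subgroup.inv_mem _ hh) (Subgroup.inv_mem _ hg)
        rw [commutatorElement_def] at this
        convert this using 1
        group
      exact ⟨mul_mem (inv_mem (mul_mem hg hh)) (mul_mem hh hg), 1, one_ne_zero, by simpa using hc⟩
    let _ : CommGroup f.ker := { (inferInstance : Group f.ker) with mul_comm := hcomm }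
    have hU : UniqueProds f.ker := by
      refine uniqueProds_of_torsionFree fun x k hk hxk => ?_
      obtain ⟨g, hg, hgx⟩ := hmk x
      have h1 : (x : G ⧸ rationalDerivedSeries G (n + 1)) ^ k = 1 := congrArg Subtype.val hxk
      rw [← hgx, ← QuotientGroup.mk_pow, QuotientGroup.eq_one_iff] at h1
      obtain ⟨-, l, hl, h2⟩ := h1
      apply Subtype.ext
      rw [← hgx]
      refine (QuotientGroup.eq_one_iff g).2 ⟨hg, k * l, mul_ne_zero (by exact_mod_cast hk) hl, ?_⟩
      rwa [zpow_mul, zpow_natCast]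
    have hS : Group.IsSolvable f.ker := inferInstance
    exact ⟨Group.isSolvable_of_ker_le_range f.ker.subtype f (by simp), uniqueProds_of_ker f⟩

variable (G) in
/-- `Γ_n = G / G_r^{(n+1)}`. -/
abbrev Gamma (n : ℕ) : Type u := G ⧸ rationalDerivedSeries G (n + 1)

instance (n : ℕ) : Group.IsSolvable (Gamma G n) := (quotient_solvable_and_uniqueProds (n + 1)).1

instance (n : ℕ) : UniqueProds (Gamma G n) := (quotient_solvable_and_uniqueProds (n + 1)).2

theorem rationalDerivedSeries_le_ker (φ : G →* Multiplicative ℤ) (n : ℕ) :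
    rationalDerivedSeries G (n + 1) ≤ φ.ker := by
  rintro g ⟨-, k, hk, h⟩
  have h1 : g ^ k ∈ φ.ker := Subgroup.commutator_le.2 (fun a _ b _ => by
    rw [MonoidHom.mem_ker, map_commutatorElement, commutatorElement_eq_one_iff_mul_comm,
      mul_comm]) h
  rw [MonoidHom.mem_ker, map_zpow] at h1
  have h2 : k * (φ g).toAdd = 0 := by simpa using congrArg Multiplicative.toAdd h1
  exact Multiplicative.toAdd.injective ((mul_eq_zero.1 h2).resolve_left hk)

/-- `Γ̄_n`, the kernel of the map `Γ_n → ℤ` induced by `φ`. -/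
abbrev GammaBar (φ : G →* Multiplicative ℤ) (n : ℕ) : Subgroup (Gamma G n) :=
  (QuotientGroup.lift (rationalDerivedSeries G (n + 1)) φ (rationalDerivedSeries_le_ker φ n)).ker

instance (n : ℕ) (H : Subgroup (Gamma G n)) : UniqueProds H :=
  UniqueProds.of_injective_mulHom H.subtype.toMulHom H.subtype_injective inferInstance

/-- The skew field `𝕂_n` of right quotients of `ℤ[Γ̄_n]`. -/
abbrev SkewField (φ : G →* Multiplicative ℤ) (n : ℕ) : Type u :=
  RightFrac (MonoidAlgebra ℤ (GammaBar φ n))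

end RationalDerivedSeries

/-! ### The Alexander modules and the higher-order degrees -/

section Degree
variable {G : Type u} [Group G]

variable (G) in
/-- The abelian group `G_r^{(n+1)} / [G_r^{(n+1)}, G_r^{(n+1)}]`, written additively. -/
abbrev AlexanderModule (n : ℕ) : Type u :=
  Additive (Abelianization (rationalDerivedSeries G (n + 1)))

/-- The right action of `g ∈ G` on the Alexander module, `[h] ↦ [g⁻¹ h g]`. -/
def rightConj (n : ℕ) (g : G) : AddMonoid.End (AlexanderModule G n) :=
  MonoidHom.toAdditive (Abelianization.map
    (MulAut.conjNormal (H := rationalDerivedSeries G (n + 1)) g⁻¹).toMonoidHom)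

theorem rightConj_of (n : ℕ) (g : G) (h : rationalDerivedSeries G (n + 1)) :
    rightConj n g (.ofMul (.of h)) = .ofMul (.of ⟨g⁻¹ * h * g, by
      simpa using (rationalDerivedSeries_normal (n + 1)).conj_mem h.1 h.2 g⁻¹⟩) := by
  change Additive.ofMul (Abelianization.of (MulAut.conjNormal g⁻¹ h)) = _
  congr 2
  apply Subtype.ext
  simp

theorem alexander_ext {n : ℕ} {a b : AddMonoid.End (AlexanderModule G n)}
    (hab : ∀ h, a (.ofMul (.of h)) = b (.ofMul (.of h))) : a = b := by
  ext x
  obtain ⟨h, rfl⟩ := QuotientGroup.mk_surjective x.toMul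
  exact hab h

/-- The right conjugation action, as a homomorphism on `Γ_n`. -/
def gammaAct (n : ℕ) : Gamma G n →* (AddMonoid.End (AlexanderModule G n))ᵐᵒᵖ :=
  QuotientGroup.lift (rationalDerivedSeries G (n + 1))
    { toFun := fun g => .op (rightConj n g)
      map_one' := MulOpposite.unop_injective <| alexander_ext fun h => by
        simp [rightConj_of]
      map_mul' := fun x y => MulOpposite.unop_injective <| alexander_ext fun h => by
        simp [rightConj_of, mul_assoc] }
    (fun g hg => MulOpposite.unop_injective <| alexander_ext fun h => by
      let g' : rationalDerivedSeries G (n + 1) := ⟨g, hg⟩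
      have e : (g'⁻¹ * h * g' : rationalDerivedSeries G (n + 1)) =
        ⟨g⁻¹ * h * g, (g'⁻¹ * h * g').2⟩ := rfl
      change rightConj n g _ = Additive.ofMul (Abelianization.of h)
      rw [rightConj_of, ← e]
      congr 1
      rw [map_mul, map_mul, map_inv, mul_right_comm, inv_mul_cancel, one_mul])

/-- The right `ℤ[Γ_n]`-module structure on the Alexander module. -/
noncomputable instance (n : ℕ) : Module (MonoidAlgebra ℤ (Gamma G n))ᵐᵒᵖ (AlexanderModule G n) :=
  Module.compHom (R := AddMonoid.End (AlexanderModule G n)) _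
    ((RingEquiv.opOp (AddMonoid.End (AlexanderModule G n))).symm.toRingHom.comp
      (RingHom.op (MonoidAlgebra.lift ℤ _ _ (gammaAct (G := G) n)).toRingHom))

/-- The right `ℤ[Γ̄_n]`-module structure, by restriction of scalars. -/
noncomputable instance (φ : G →* Multiplicative ℤ) (n : ℕ) :
    Module (MonoidAlgebra ℤ (GammaBar φ n))ᵐᵒᵖ (AlexanderModule G n) :=
  Module.compHom _
    (RingHom.op (MonoidAlgebra.mapDomainRingHom ℤ (GammaBar φ n).subtype))

/-- The first higher-order degree `δ_n(G)` with respect to `φ : G → ℤ`: the rank over `𝕂_n` of the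
right vector space `G_r^{(n+1)} / [G_r^{(n+1)}, G_r^{(n+1)}] ⊗ 𝕂_n`, the tensor product being taken
over `ℤ[Γ̄_n]`. -/
noncomputable def degree (φ : G →* Multiplicative ℤ) (n : ℕ) : Cardinal.{u} :=
  Module.rank (SkewField φ n)ᵐᵒᵖ
    (BalancedTensor (toRightFrac (MonoidAlgebra ℤ (GammaBar φ n))) (AlexanderModule G n))

end Degree

/-! ### Torsion elements -/

section Torsion
variable (G : Type u) [Group G]

/-- The set of torsion elements of `G`. -/
def torsionElements : Set G := {h | ∃ k : ℕ, 0 < k ∧ h ^ k = 1}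

/-- The normal subgroup generated by the torsion elements of `G`. -/
abbrev torsionClosure : Subgroup G := Subgroup.normalClosure (torsionElements G)

variable {G} in
theorem torsionClosure_le_ker (φ : G →* Multiplicative ℤ) : torsionClosure G ≤ φ.ker := by
  refine Subgroup.normalClosure_le_normal ?_
  rintro h ⟨k, hk, hh⟩
  have h1 : (φ h) ^ k = 1 := by rw [← map_pow, hh, map_one]
  have h2 : (k : ℤ) * (φ h).toAdd = 0 := by simpa using congrArg Multiplicative.toAdd h1
  exact Multiplicative.toAdd.injective ((mul_eq_zero.1 h2).resolve_left (by exact_mod_cast hk.ne'))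

variable {G} in
/-- The map induced by `φ : G → ℤ` on the quotient of `G` by its torsion closure. -/
def inducedMap (φ : G →* Multiplicative ℤ) : G ⧸ torsionClosure G →* Multiplicative ℤ :=
  QuotientGroup.lift (torsionClosure G) φ (torsionClosure_le_ker φ)

end Torsion

end HigherOrderDegree

namespace HigherOrderDegree

/-! ### Surjections with kernel generated by torsion -/

section Groups
variable {G G' : Type u} [Group G] [Group G']

/-! All three equalities are instances of `degree_comp_eq`: each compares two groups related by a
surjection `f : G → G'` whose kernel lies in the normal closure of the torsion.

A torsion element survives every step of the rational derived series, because a power of it is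
trivial. So `ker f` lies in every term, and each term for `G` is the full preimage of the one for
`G'` (`rationalDerivedSeries_eq_comap`). Hence `f` identifies the groups `Γ_n`, the subgroups
`Γ̄_n`, their group rings and the skew fields `𝕂_n`.

The Alexander modules need not be isomorphic, since the torsion closure need not lie in the
commutator subgroup of a term. The induced map is onto, and its kernel is `ℤ`-torsion because `ker
f` also lies in the next term of the series (`exists_zsmul_eq_zero_of_alexanderMap_eq_zero`).
Nonzero integers are invertible in `𝕂_n`, so this kernel dies in the tensor product. What remains is
an additive isomorphism, semilinear over the isomorphism of skew fields
(`exists_balancedTensor_equiv`), and it preserves rank. -/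

theorem torsionClosure_le_rationalDerivedSeries (n : ℕ) :
    torsionClosure G ≤ rationalDerivedSeries G n := by
  induction n with
  | zero => exact le_top
  | succ n ih =>
    refine Subgroup.normalClosure_le_normal fun h hh => ?_
    refine ⟨ih (Subgroup.subset_normalClosure hh), ?_⟩
    obtain ⟨k, hk, hk1⟩ := hh
    exact ⟨k, by exact_mod_cast hk.ne', by rw [zpow_natCast, hk1]; exact one_mem _⟩

theorem map_commutator_of_eq_comap {f : G →* G'} (hf : Function.Surjective f) {P : Subgroup G}
    {P' : Subgroup G'} (h : P = P'.comap f) : ⁅P, P⁆.map f = ⁅P', P'⁆ := by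
  rw [Subgroup.map_commutator, h, Subgroup.map_comap_eq_self_of_surjective hf]

theorem commutator_le_rationalCommutator (P : Subgroup G) [P.Normal] :
    ⁅P, P⁆ ≤ rationalCommutator P := fun x hx =>
  ⟨Subgroup.commutator_le_left P P hx, 1, one_ne_zero, by simpa using hx⟩

/-- Only the inclusion of the preimage needs the kernel hypothesis: a power of `x` that is a product
of commutators after applying `f` is one already in `G`, up to an element of `ker f`, and that error
disappears after passing to a further power. -/
theorem rationalDerivedSeries_eq_comap {f : G →* G'} (hf : Function.Surjective f)
    (hk : f.ker ≤ torsionClosure G) (n : ℕ) :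
    rationalDerivedSeries G n = (rationalDerivedSeries G' n).comap f := by
  induction n with
  | zero => exact (Subgroup.comap_top f).symm
  | succ n ih =>
    have hm := map_commutator_of_eq_comap hf ih
    ext x
    have hx0 : x ∈ rationalDerivedSeries G n ↔ f x ∈ rationalDerivedSeries G' n := by
      rw [ih, Subgroup.mem_comap]
    constructor
    · rintro ⟨hx, k, hk0, hxk⟩
      refine ⟨hx0.1 hx, k, hk0, ?_⟩
      rw [← hm, ← map_zpow]
      exact Subgroup.mem_map_of_mem f hxk
    · rintro ⟨hx, k, hk0, hxk⟩
      rw [← hm, ← map_zpow] at hxk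
      obtain ⟨c, hc, hcx⟩ := hxk
      -- This element lies in `ker f`. As `c` is in the same term, so is `x ^ k`, and the definition
      -- of that term supplies the second exponent `l`.
      have h1 : c⁻¹ * x ^ k ∈ rationalDerivedSeries G (n + 1) :=
        torsionClosure_le_rationalDerivedSeries _ (hk (by simp [MonoidHom.mem_ker, hcx]))
      have h2 : c ∈ rationalDerivedSeries G (n + 1) := commutator_le_rationalCommutator _ hc
      obtain ⟨-, l, hl, h3⟩ := (Subgroup.mul_mem_cancel_left _ (inv_mem h2)).1 h1
      exact ⟨hx0.2 hx, k * l, mul_ne_zero hk0 hl, by rwa [zpow_mul]⟩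

variable {f : G →* G'} (hf : Function.Surjective f) (hk : f.ker ≤ torsionClosure G)

/-- The isomorphism of the quotients `Γ_n` induced by a surjection with kernel generated by
torsion. -/
noncomputable def gammaEquiv (n : ℕ) : Gamma G n ≃* Gamma G' n :=
  MulEquiv.ofBijective
    (QuotientGroup.map _ _ f (rationalDerivedSeries_eq_comap hf hk (n + 1)).le) <| by
    constructor
    · rw [← MonoidHom.ker_eq_bot_iff, QuotientGroup.ker_map,
        ← rationalDerivedSeries_eq_comap hf hk (n + 1), QuotientGroup.map_mk'_self]
    · intro y
      obtain ⟨y, rfl⟩ := QuotientGroup.mk_surjective y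
      obtain ⟨x, rfl⟩ := hf y
      exact ⟨x, rfl⟩

/-- The isomorphism of the subgroups `Γ̄_n` induced by a surjection with kernel generated by
torsion. -/
noncomputable def gammaBarEquiv (φ : G' →* Multiplicative ℤ) (n : ℕ) :
    GammaBar (φ.comp f) n ≃* GammaBar φ n :=
  ((gammaEquiv hf hk n).subgroupMap _).trans <| MulEquiv.subgroupCongr <| by
    have h : GammaBar (φ.comp f) n =
        (GammaBar φ n).comap (gammaEquiv hf hk n).toMonoidHom := by
      ext x
      obtain ⟨x, rfl⟩ := QuotientGroup.mk_surjective x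
      exact Iff.rfl
    rw [h]
    exact Subgroup.map_comap_eq_self_of_surjective (gammaEquiv hf hk n).surjective _

theorem coe_gammaBarEquiv (φ : G' →* Multiplicative ℤ) (n : ℕ) (x : GammaBar (φ.comp f) n) :
    (gammaBarEquiv hf hk φ n x : Gamma G' n) = gammaEquiv hf hk n x := rfl

/-- The map of terms of the rational derived series induced by a surjection with kernel generated by
torsion. -/
def seriesMap (n : ℕ) : rationalDerivedSeries G n →* rationalDerivedSeries G' n :=
  (f.domRestrict _).codRestrict _ fun x => (rationalDerivedSeries_eq_comap hf hk n).le x.2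

/-- The induced map of Alexander modules. -/
def alexanderMap (n : ℕ) : AlexanderModule G n →+ AlexanderModule G' n :=
  (Abelianization.map (seriesMap hf hk (n + 1))).toAdditive

theorem alexanderMap_of (n : ℕ) (h : rationalDerivedSeries G (n + 1)) :
    alexanderMap hf hk n (.ofMul (.of h)) = .ofMul (.of (seriesMap hf hk (n + 1) h)) := rfl

theorem exists_of_eq {n : ℕ} (a : AlexanderModule G n) :
    ∃ h, a = .ofMul (.of h) := by
  obtain ⟨h, hh⟩ := QuotientGroup.mk_surjective a.toMul
  exact ⟨h, hh.symm⟩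

theorem alexanderMap_surjective (n : ℕ) : Function.Surjective (alexanderMap hf hk n) := by
  intro b
  obtain ⟨⟨y, hy⟩, rfl⟩ := exists_of_eq b
  obtain ⟨x, rfl⟩ := hf y
  exact ⟨.ofMul (.of ⟨x, (rationalDerivedSeries_eq_comap hf hk (n + 1)).ge hy⟩), rfl⟩

/-- A representative of a class in the kernel is a product of commutators times an element of `ker
f`. Both factors lie in the next term of the series, and by definition that term consists of the
elements with torsion class in the abelianization. -/
theorem exists_zsmul_eq_zero_of_alexanderMap_eq_zero {n : ℕ} {a : AlexanderModule G n}
    (ha : alexanderMap hf hk n a = 0) : ∃ k : ℤ, k ≠ 0 ∧ k • a = 0 := by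
  obtain ⟨x, rfl⟩ := exists_of_eq a
  rw [alexanderMap_of] at ha
  have h1 : f x ∈ ⁅rationalDerivedSeries G' (n + 1), rationalDerivedSeries G' (n + 1)⁆ :=
    (mem_commutator_iff _ (seriesMap hf hk (n + 1) x)).2 ha
  rw [← map_commutator_of_eq_comap hf (rationalDerivedSeries_eq_comap hf hk (n + 1))] at h1
  obtain ⟨c, hc, hcx⟩ := h1
  -- The index is `n + 2`: torsion in the abelianization of term `n + 1` is what term `n + 2`
  -- records.
  have h2 : c⁻¹ * x ∈ rationalDerivedSeries G (n + 2) :=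
    torsionClosure_le_rationalDerivedSeries _ (hk (by simp [MonoidHom.mem_ker, hcx]))
  have h3 : c ∈ rationalDerivedSeries G (n + 2) := commutator_le_rationalCommutator _ hc
  obtain ⟨-, l, hl, h4⟩ := (Subgroup.mul_mem_cancel_left _ (inv_mem h3)).1 h2
  refine ⟨l, hl, ?_⟩
  have h5 := (mem_commutator_iff _ (x ^ l)).1 h4
  rw [map_zpow] at h5
  exact h5

theorem gammaAct_mk_of (n : ℕ) (g : G) (h : rationalDerivedSeries G (n + 1)) :
    (gammaAct n (QuotientGroup.mk g : Gamma G n)).unop (.ofMul (.of h)) =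
      .ofMul (.of ⟨g⁻¹ * h * g, by
      simpa using (rationalDerivedSeries_normal (n + 1)).conj_mem h.1 h.2 g⁻¹⟩) :=
  rightConj_of n g h

theorem alexanderMap_gammaAct (n : ℕ) (g : Gamma G n) (a : AlexanderModule G n) :
    alexanderMap hf hk n ((gammaAct n g).unop a) =
      (gammaAct n (gammaEquiv hf hk n g)).unop (alexanderMap hf hk n a) := by
  obtain ⟨g, rfl⟩ := QuotientGroup.mk_surjective g
  obtain ⟨h, rfl⟩ := exists_of_eq a
  have e : gammaEquiv hf hk n (g : Gamma G n) = (f g : Gamma G' n) := rfl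
  rw [e, gammaAct_mk_of, alexanderMap_of, alexanderMap_of, gammaAct_mk_of]
  congr 2
  apply Subtype.ext
  change f (g⁻¹ * h * g) = (f g)⁻¹ * f h * f g
  rw [map_mul, map_mul, map_inv]

theorem op_single_smul (φ : G →* Multiplicative ℤ) (n : ℕ) (g : GammaBar φ n) (c : ℤ)
    (a : AlexanderModule G n) :
    MulOpposite.op (MonoidAlgebra.single g c) • a = c • (gammaAct n (g : Gamma G n)).unop a := by
  -- Unfolds both module structures: restriction from `ℤ[Γ̄_n]` to `ℤ[Γ_n]`, then the linear
  -- extension of the conjugation action.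
  change (MonoidAlgebra.lift ℤ _ _ (gammaAct (G := G) n)
    (MonoidAlgebra.mapDomainRingHom ℤ (GammaBar φ n).subtype (MonoidAlgebra.single g c))).unop a = _
  rw [MonoidAlgebra.mapDomainRingHom_apply, MonoidAlgebra.mapDomain_single,
    MonoidAlgebra.lift_single, MulOpposite.unop_smul]
  rfl

theorem alexanderMap_smul (φ : G' →* Multiplicative ℤ) (n : ℕ)
    (r : MonoidAlgebra ℤ (GammaBar (φ.comp f) n)) (a : AlexanderModule G n) :
    alexanderMap hf hk n (MulOpposite.op r • a) =
      MulOpposite.op (MonoidAlgebra.mapDomainRingEquiv ℤ (gammaBarEquiv hf hk φ n) r) •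
        alexanderMap hf hk n a := by
  induction r using MonoidAlgebra.induction_linear with
  | zero => simp
  | add r s hr hs => rw [MulOpposite.op_add, add_smul, map_add, hr, hs, map_add,
      MulOpposite.op_add, add_smul]
  | single g c =>
    rw [op_single_smul, map_zsmul, alexanderMap_gammaAct, MonoidAlgebra.mapDomainRingEquiv_single,
      op_single_smul, coe_gammaBarEquiv]

end Groups

/-! ### Kernels of the projections of `G * H` and `G × H` onto `G`, for `H` torsion -/

/-- The quotient map by the torsion closure kills `H`, so by the universal property of the free
product it factors through the retraction onto `G`. No computation with reduced words is needed. -/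
theorem ker_coprodLift_id_one_le {G H : Type*} [Group G] [Group H]
    (hH : ∀ z : H, z ∈ torsionElements H) :
    (Monoid.Coprod.lift (MonoidHom.id G) (1 : H →* G)).ker ≤
      torsionClosure (Monoid.Coprod G H) := by
  intro x hx
  have h : QuotientGroup.mk' (torsionClosure (Monoid.Coprod G H)) =
      ((QuotientGroup.mk' (torsionClosure (Monoid.Coprod G H))).comp Monoid.Coprod.inl).comp
        (Monoid.Coprod.lift (MonoidHom.id G) (1 : H →* G)) := by
    refine Monoid.Coprod.hom_ext rfl (MonoidHom.ext fun z => ?_)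
    obtain ⟨k, hk, hz⟩ := hH z
    have : (Monoid.Coprod.inr z : Monoid.Coprod G H) ∈ torsionClosure (Monoid.Coprod G H) :=
      Subgroup.subset_normalClosure ⟨k, hk, by rw [← map_pow, hz, map_one]⟩
    simpa using this
  rw [← QuotientGroup.ker_mk' (torsionClosure _), MonoidHom.mem_ker, h, MonoidHom.comp_apply, hx,
    map_one]

theorem ker_fst_le {G H : Type*} [Group G] [Group H] (hH : ∀ z : H, z ∈ torsionElements H) :
    (MonoidHom.fst G H).ker ≤ torsionClosure (G × H) := by
  rintro ⟨g, z⟩ (rfl : g = 1)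
  obtain ⟨k, hk, hz⟩ := hH z
  exact Subgroup.subset_normalClosure ⟨k, hk, by simp [hz]⟩

theorem mem_torsionElements_of_finite {H : Type*} [Group H] [Finite H] (z : H) :
    z ∈ torsionElements H :=
  ⟨orderOf z, orderOf_pos z, pow_orderOf_eq_one z⟩

/-! ### Functoriality of rings of quotients and tensor products -/

section Fractions

/-- The homomorphism of Ore localizations at the nonzerodivisors induced by an isomorphism. -/
noncomputable def oreMap {R R' : Type*} [Ring R] [Ring R']
    [OreLocalization.OreSet (nonZeroDivisors R)] [OreLocalization.OreSet (nonZeroDivisors R')]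
    (σ : R ≃+* R') :
    OreLocalization (nonZeroDivisors R) R →+* OreLocalization (nonZeroDivisors R') R' :=
  OreLocalization.universalHom (OreLocalization.numeratorRingHom.comp σ.toRingHom)
    (IsUnit.liftRight (((OreLocalization.numeratorRingHom (S := nonZeroDivisors R')).comp
        σ.toRingHom).toMonoidHom.domRestrict (nonZeroDivisors R))
      fun s => OreLocalization.numerator_isUnit
        (⟨σ s, (MulEquivClass.map_nonZeroDivisors σ).le ⟨s, s.2, rfl⟩⟩ : nonZeroDivisors R'))
    fun _ => rfl

theorem oreMap_numerator {R R' : Type*} [Ring R] [Ring R']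
    [OreLocalization.OreSet (nonZeroDivisors R)] [OreLocalization.OreSet (nonZeroDivisors R')]
    (σ : R ≃+* R') (r : R) :
    oreMap σ (OreLocalization.numeratorHom r) = OreLocalization.numeratorHom (σ r) :=
  OreLocalization.universalHom_commutes _ _ _

/-- Maps out of an Ore localization are determined by their values on numerators. The identity is
first rewritten as a `universalHom`, the form in which uniqueness applies. No relation between the
chosen Ore structures on `R` and `R'` is required. -/
theorem oreMap_comp {R R' : Type*} [Ring R] [Ring R']
    [OreLocalization.OreSet (nonZeroDivisors R)] [OreLocalization.OreSet (nonZeroDivisors R')]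
    (σ : R ≃+* R') : (oreMap σ.symm).comp (oreMap σ) = RingHom.id _ := by
  have h1 : oreMap (RingEquiv.refl R) = RingHom.id _ :=
    (OreLocalization.universalHom_unique _ _ _ _ fun r => rfl).symm
  rw [← h1]
  exact OreLocalization.universalHom_unique _ _ _ _ fun r => by
    rw [RingHom.comp_apply, oreMap_numerator, oreMap_numerator, RingEquiv.symm_apply_apply]; rfl

/-- Isomorphic rings have isomorphic rings of right quotients. -/
noncomputable def rightFracEquiv {R R' : Type*} [Ring R] [Ring R']
    [OreLocalization.OreSet (nonZeroDivisors Rᵐᵒᵖ)]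
    [OreLocalization.OreSet (nonZeroDivisors R'ᵐᵒᵖ)] (σ : R ≃+* R') :
    RightFrac R ≃+* RightFrac R' :=
  RingEquiv.op (RingEquiv.ofRingHom (oreMap (RingEquiv.op σ)) (oreMap (RingEquiv.op σ).symm)
    (oreMap_comp (RingEquiv.op σ).symm) (oreMap_comp (RingEquiv.op σ)))

theorem rightFracEquiv_toRightFrac {R R' : Type*} [Ring R] [Ring R']
    [OreLocalization.OreSet (nonZeroDivisors Rᵐᵒᵖ)]
    [OreLocalization.OreSet (nonZeroDivisors R'ᵐᵒᵖ)] (σ : R ≃+* R') (r : R) :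
    rightFracEquiv σ (toRightFrac R r) = toRightFrac R' (σ r) :=
  MulOpposite.unop_injective (oreMap_numerator (RingEquiv.op σ) (.op r))

theorem isUnit_toRightFrac {R : Type*} [Ring R] [OreLocalization.OreSet (nonZeroDivisors Rᵐᵒᵖ)]
    {r : R} (hr : MulOpposite.op r ∈ nonZeroDivisors Rᵐᵒᵖ) : IsUnit (toRightFrac R r) :=
  (OreLocalization.numerator_isUnit (⟨.op r, hr⟩ : nonZeroDivisors Rᵐᵒᵖ)).op

/-- The group ring has characteristic zero and, by unique products, no zero divisors, so a nonzero
integer is among the inverted elements. -/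
theorem isUnit_intCast_rightFrac (G : Type*) [Group G] [Group.IsSolvable G] [UniqueProds G]
    {k : ℤ} (hk : k ≠ 0) : IsUnit (k : RightFrac (MonoidAlgebra ℤ G)) := by
  rw [← map_intCast (toRightFrac (MonoidAlgebra ℤ G))]
  refine isUnit_toRightFrac (mem_nonZeroDivisors_of_ne_zero fun h => hk ?_)
  have h1 : (k : MonoidAlgebra ℤ G) = 0 := MulOpposite.op_injective h
  simpa [MonoidAlgebra.intCast_def] using h1

end Fractions

/-! ### Balanced tensor products and their comparison -/

section Tensor
open scoped TensorProduct
variable {R K A R' K' A' : Type*} [Ring R] [Ring K] [Ring R'] [Ring K'] [AddCommGroup A]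
  [Module Rᵐᵒᵖ A] [AddCommGroup A'] [Module R'ᵐᵒᵖ A'] (i : R →+* K) (i' : R' →+* K')

/-- The pure tensors of `A ⊗_R K`, as a biadditive map. -/
def balancedMk : K →+ A →+ BalancedTensor i A :=
  AddMonoidHom.mk' (fun k => AddMonoidHom.mk' (fun a => Submodule.Quotient.mk (k ⊗ₜ[ℤ] a))
      fun a b => by rw [TensorProduct.tmul_add]; rfl)
    fun k l => by ext a; exact congrArg Submodule.Quotient.mk (TensorProduct.add_tmul k l a)

theorem balancedMk_smul (r : R) (k : K) (a : A) :
    balancedMk i k (MulOpposite.op r • a) = balancedMk i (i r * k) a :=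
  (Submodule.Quotient.eq _).2 (Submodule.subset_span ⟨r, k, a, rfl⟩)

theorem op_smul_balancedMk (c k : K) (a : A) :
    MulOpposite.op c • balancedMk i k a = balancedMk i (k * c) a := rfl

variable {i} in
theorem balancedTensor_induction {p : BalancedTensor i A → Prop} (x : BalancedTensor i A)
    (zero : p 0) (mk : ∀ k a, p (balancedMk i k a)) (add : ∀ x y, p x → p y → p (x + y)) : p x := by
  obtain ⟨x, rfl⟩ := Submodule.Quotient.mk_surjective _ x
  induction x with
  | zero => exact zero
  | tmul k a => exact mk k a
  | add x y hx hy => exact add _ _ hx hy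

/-- A balanced biadditive map induces an additive map on `A ⊗_R K`. -/
def balancedLift {B : Type*} [AddCommGroup B] (b : K →+ A →+ B)
    (hb : ∀ r k a, b k (MulOpposite.op r • a) = b (i r * k) a) : BalancedTensor i A →+ B :=
  QuotientAddGroup.lift _ (TensorProduct.liftAddHom b fun n k a => by
    rw [map_zsmul, map_zsmul, AddMonoidHom.zsmul_apply]) <| by
    intro x hx
    induction hx using Submodule.closure_induction with
    | zero => exact zero_mem _
    | add x y _ _ hx hy => exact add_mem hx hy
    | smul_mem c x hx =>
      obtain ⟨r, k, a, rfl⟩ := hx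
      -- A scalar multiple of a relation is the same relation with `k` replaced by `k * c.unop`, so
      -- killing the relations additively already kills their `Kᵐᵒᵖ`-span.
      have e : c • (k ⊗ₜ[ℤ] (MulOpposite.op r • a) - (i r * k) ⊗ₜ[ℤ] a) =
        (k * c.unop) ⊗ₜ[ℤ] (MulOpposite.op r • a) - (i r * (k * c.unop)) ⊗ₜ[ℤ] a := by
        rw [smul_sub, TensorProduct.smul_tmul', TensorProduct.smul_tmul', ← mul_assoc]
        rfl
      rw [e, AddMonoidHom.mem_ker, map_sub, sub_eq_zero]
      exact hb _ _ _

/-- Write `x` as `k` times `k⁻¹ x` and move the integer `k` across to `a`. -/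
theorem balancedMk_eq_zero_of_zsmul {k : ℤ} (hk : IsUnit (k : K)) {a : A} (ha : k • a = 0)
    (x : K) : balancedMk i x a = 0 := by
  obtain ⟨u, hu⟩ := hk
  have h : x = k • (↑u⁻¹ * x) := by rw [zsmul_eq_mul, ← hu, Units.mul_inv_cancel_left]
  rw [h, map_zsmul, AddMonoidHom.zsmul_apply, ← map_zsmul, ha, map_zero]

variable {i i'}

/-- Isomorphisms of the rings and a semilinear surjection of modules with torsion kernel induce an
isomorphism of the tensor products, if the nonzero integers are invertible in `K`. -/
theorem exists_balancedTensor_equiv (σ : R ≃+* R') (τ : K ≃+* K')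
    (hτ : ∀ r, τ (i r) = i' (σ r)) (π : A →+ A') (hπ : Function.Surjective π)
    (hπs : ∀ (r : R) (a : A), π (MulOpposite.op r • a) = MulOpposite.op (σ r) • π a)
    (hπk : ∀ a, π a = 0 → ∃ k : ℤ, k ≠ 0 ∧ k • a = 0)
    (hK : ∀ k : ℤ, k ≠ 0 → IsUnit (k : K)) :
    ∃ e : BalancedTensor i A ≃+ BalancedTensor i' A',
      ∀ (c : Kᵐᵒᵖ) (x), e (c • x) = RingEquiv.op τ c • e x := by
  let F : BalancedTensor i A →+ BalancedTensor i' A' :=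
    balancedLift i ((AddMonoidHom.compHom' π).comp ((balancedMk i').comp τ.toAddMonoidHom))
      fun r k a => by
        change balancedMk i' (τ k) (π _) = balancedMk i' (τ _) (π a)
        rw [hπs, balancedMk_smul, map_mul τ, hτ]
  have hF : ∀ k a, F (balancedMk i k a) = balancedMk i' (τ k) (π a) := fun _ _ => rfl
  -- Elements of `ker π` are torsion, so all their pure tensors vanish. Hence `a ↦ (x ↦ x ⊗ a)`
  -- descends along `π` to a map `m` on `A'`, from which the inverse of `F` is built.
  have hker : π.ker ≤ (balancedMk (A := A) i).flip.ker := fun a ha => by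
    obtain ⟨k, hk, hka⟩ := hπk a ha
    exact AddMonoidHom.ext fun x => balancedMk_eq_zero_of_zsmul i (hK k hk) hka x
  let m : A' →+ K →+ BalancedTensor i A :=
    π.liftOfSurjective hπ ⟨(balancedMk i).flip, hker⟩
  have hm : ∀ a k, m (π a) k = balancedMk i k a := fun a k =>
    DFunLike.congr_fun (AddMonoidHom.liftOfRightInverse_comp_apply π _
      (Function.rightInverse_surjInv hπ) ⟨(balancedMk i).flip, hker⟩ a) k
  let F' : BalancedTensor i' A' →+ BalancedTensor i A :=
    balancedLift i' (m.flip.comp τ.symm.toAddMonoidHom) fun r k b => by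
      obtain ⟨a, rfl⟩ := hπ b
      -- Balancedness over `R'` is pulled back along `π`, `σ` and `τ` to the relation already known
      -- over `R`.
      obtain ⟨r, rfl⟩ := σ.surjective r
      obtain ⟨k, rfl⟩ := τ.surjective k
      change m _ (τ.symm (τ k)) = m (π a) (τ.symm (i' (σ r) * τ k))
      rw [← hπs, ← hτ, ← map_mul, τ.symm_apply_apply, τ.symm_apply_apply, hm, hm, balancedMk_smul]
  have hF' : ∀ k a, F' (balancedMk i' (τ k) (π a)) = balancedMk i k a := fun k a => by
    change m (π a) (τ.symm (τ k)) = _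
    rw [hm, τ.symm_apply_apply]
  refine ⟨{ F with invFun := F', left_inv := fun x => ?_, right_inv := fun x => ?_ },
    fun c x => ?_⟩
  · change F' (F x) = x
    induction x using balancedTensor_induction with
    | zero => simp
    | mk k a => rw [hF, hF']
    | add x y hx hy => rw [map_add, map_add, hx, hy]
  · change F (F' x) = x
    induction x using balancedTensor_induction with
    | zero => simp
    | mk k a =>
      obtain ⟨a, rfl⟩ := hπ a
      obtain ⟨k, rfl⟩ := τ.surjective k
      rw [hF', hF]
    | add x y hx hy => rw [map_add, map_add, hx, hy]
  · change F (c • x) = RingEquiv.op τ c • F x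
    induction x using balancedTensor_induction with
    | zero => simp
    | mk k a =>
      obtain ⟨c, rfl⟩ := MulOpposite.op_surjective c
      rw [op_smul_balancedMk, hF, hF, map_mul]
      rfl
    | add x y hx hy => rw [smul_add, map_add, map_add, smul_add, hx, hy]

end Tensor

/-- The higher-order degrees do not change under a surjection with kernel generated by torsion. -/
theorem degree_comp_eq {G G' : Type u} [Group G] [Group G'] {f : G →* G'}
    (hf : Function.Surjective f) (hk : f.ker ≤ torsionClosure G) (φ : G' →* Multiplicative ℤ)
    (n : ℕ) : degree (φ.comp f) n = degree φ n := by
  obtain ⟨e, he⟩ := exists_balancedTensor_equiv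
    (i := toRightFrac (MonoidAlgebra ℤ (GammaBar (φ.comp f) n)))
    (i' := toRightFrac (MonoidAlgebra ℤ (GammaBar φ n)))
    (MonoidAlgebra.mapDomainRingEquiv ℤ (gammaBarEquiv hf hk φ n)) (rightFracEquiv _)
    (rightFracEquiv_toRightFrac _) (alexanderMap hf hk n) (alexanderMap_surjective hf hk n)
    (alexanderMap_smul hf hk φ n) (fun a => exists_zsmul_eq_zero_of_alexanderMap_eq_zero hf hk)
    (fun k hk => isUnit_intCast_rightFrac _ hk)
  exact rank_eq_of_equiv_equiv _ e (RingEquiv.bijective _) he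

end HigherOrderDegree

theorem proposition10p2 {G : Type u} [Group G] (φ : G →* Multiplicative ℤ) (n : ℕ) :
    HigherOrderDegree.degree φ n
        = HigherOrderDegree.degree (HigherOrderDegree.inducedMap φ) n ∧
      ∀ d : ℕ, 0 < d →
        HigherOrderDegree.degree (φ.comp (MonoidHom.fst G (Multiplicative (ZMod d)))) n
            = HigherOrderDegree.degree φ n ∧
          HigherOrderDegree.degree φ n
            = HigherOrderDegree.degree
                (Monoid.Coprod.lift φ (1 : Multiplicative (ZMod d) →* Multiplicative ℤ)) n := by
  refine ⟨?_, fun d hd => ?_⟩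
  -- The composite of `inducedMap φ` with the projection is `φ` by definition.
  · exact HigherOrderDegree.degree_comp_eq (QuotientGroup.mk'_surjective _)
      (QuotientGroup.ker_mk' _).le (HigherOrderDegree.inducedMap φ) n
  -- Positivity of `d` makes `ZMod d` finite, hence torsion; `ZMod 0` is `ℤ`.
  have : NeZero d := ⟨hd.ne'⟩
  have : Finite (Multiplicative (ZMod d)) := inferInstanceAs (Finite (ZMod d))
  constructor
  · exact HigherOrderDegree.degree_comp_eq (fun g => ⟨(g, 1), rfl⟩)
      (HigherOrderDegree.ker_fst_le HigherOrderDegree.mem_torsionElements_of_finite) φ n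
  -- The homomorphism on the free product factors through the retraction onto `G`, which is the
  -- surjection to use.
  · have h : Monoid.Coprod.lift φ (1 : Multiplicative (ZMod d) →* Multiplicative ℤ) =
        φ.comp (Monoid.Coprod.lift (MonoidHom.id G) 1) :=
      Monoid.Coprod.hom_ext rfl (MonoidHom.ext fun z => by simp)
    rw [h]
    exact (HigherOrderDegree.degree_comp_eq
      (fun g => ⟨Monoid.Coprod.inl g, Monoid.Coprod.lift_apply_inl _ _ _⟩)
      (HigherOrderDegree.ker_coprodLift_id_one_le
        HigherOrderDegree.mem_torsionElements_of_finite) φ n).symm
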